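/- Let $L$ be a first-order language, $T$ an $L$-theory, and $\varphi(x,y)$ an $L$-formula, where $x$ and $y$ are finite tuples of variables (their entries need not all occur in $\varphi$). Structures are nonempty. Write $\varphi^{0}=\varphi$ and $\varphi^{1}=\neg\varphi$. For $M\models T$ and $a\in M^{y}$ put $\varphi(M,a)=\{b\in M^{x} : M\models\varphi(b,a)\}$. A subset $A$ of a set $X$ is shattered by $\mathcal F\subseteq\mathcal P(X)$ if every $S\subseteq A$ is of the form $F\cap A$ with $F\in\mathcal F$; $\mathcal F$ is a VC-class if for some $n<\omega$ no subset of $X$ of size $n$ is shattered by $\mathcal F$. The formula $\varphi$ is NIP in $T$ if for every $M\models T$ the family $\{\varphi(M,a) : a\in M^{y}\}$ is a VC-class. For $A\subseteq M^{y}$, $S_\varphi(A)$ is the set of complete $\varphi$-types over $A$: sets $p(x)$ of formulas of the form $\varphi(x,a)$ or $\neg\varphi(x,a)$ with $a\in A$ that are finitely satisfiable in $M$ and contain, for each $a\in A$, one of $\varphi(x,a)$, $\neg\varphi(x,a)$. A formula $\psi(y)$, possibly with parameters from $M$, defines $p$ if for all $b\in A$: $M\models\psi(b)$ if and only if $\varphi(x,b)\in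 p$. Below, $z$ is a finite sequence $(z_i)_{i<k}$ in which each $z_i$ is a tuple of variables of the same length as $y$, and $A^{z}$ is the set of sequences $(a_i)_{i<k}$ with all $a_i\in A$. The formula $\varphi(x,y)$ has uniform definability of types over finite sets (UDTFS) in $T$ if there is a formula $\psi(y,z)$ such that for every $M\models T$, every finite $A\subseteq M^{y}$ with $|A|\ge 2$ and every $p\in S_\varphi(A)$, there is $c\in A^{z}$ such that $\psi(y,c)$ defines $p$. Then the following are equivalent: (1) $\varphi(x,y)$ is NIP in $T$. (2) There is an integer $K\ge 0$ such that for every $M\models T$, every finite nonempty $A\subseteq M^{y}$ and every $p\in S_\varphi(A)$, there are a formula $\psi(y,z)$ with $z=(z_i)_{i<K}$, which is a finite disjunction of formulas each of the form $$\exists d_0,\dots,d_{m-1}\Bigl(\bigwedge_{t<m}\bigwedge_{i\in s_t}\varphi(d_t,z_i)^{\varepsilon_{i,t}}\wedge\bigwedge_{t\in s}\varphi(d_t,y)\Bigr),$$ where $m\le K$, $s\subseteq\{0,\dots,m-1\}$, and for every $t<m$, $s_t\subseteq\{0,\dots,K-1\}$ and $\varepsilon_{i,t}\in\{0,1\}$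 for $i\in s_t$, and a tuple $a\in A^{z}$, such that $\psi(y,a)$ defines $p$. (3) The same as (2), with each disjunct of the form $$\forall d_0,\dots,d_{m-1}\Bigl(\bigwedge_{t<m}\bigwedge_{i\in s_t}\varphi(d_t,z_i)^{\varepsilon_{i,t}}\rightarrow\bigwedge_{t\in s}\varphi(d_t,y)\Bigr).$$ (4) $\varphi(x,y)$ has UDTFS in $T$. In (2) and (3) each $d_t$ is a tuple of variables of the same length as $x$, and the empty disjunction (false) and empty conjunction (true) are allowed. -/

import Mathlib

open FirstOrder

universe u v w u' v'

namespace UDTFS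

section VC

variable {X : Type*}

/-- `A` is shattered by the family `F` of subsets of `X`. -/
def Shatters (F : Set (Set X)) (A : Set X) : Prop :=
  ∀ S ⊆ A, ∃ B ∈ F, B ∩ A = S

/-- `F` is a VC-class: for some `n`, no subset of `X` of size `n` is shattered by `F`. -/
def IsVCClass (F : Set (Set X)) : Prop :=
  ∃ n : ℕ, ∀ A : Finset X, A.card = n → ¬ Shatters F (A : Set X)

end VC

section Types

variable {L : FirstOrder.Language.{u, v}} {α : Type u'} {β : Type v'} {M : Type w} [L.Structure M]

/-- The formula `θ(x, c)` with parameters from `M`, obtained from `θ(x, y)` by substituting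
(constants naming) the tuple `c` for the variables `y`. -/
def withParams (θ : L.Formula (α ⊕ β)) (c : β → M) : (L[[M]]).Formula α :=
  ((L.lhomWithConstants M).onFormula θ).subst
    (Sum.elim (fun i => FirstOrder.Language.Term.var i) (fun j => (L.con (c j)).term))

/-- The set `φ(M, a)` of all `b` in `M ^ x` such that `M ⊨ φ(b, a)`. -/
def solutionSet (φ : L.Formula (α ⊕ β)) (a : β → M) : Set (α → M) :=
  {b | φ.Realize (Sum.elim b a)}

/-- `p ∈ S_φ(A)`: `p` is a complete `φ`-type over `A ⊆ M ^ y`, that is, a set of formulas of the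
form `φ(x, a)` or `¬ φ(x, a)` with `a ∈ A`, containing at least one of these two for every
`a ∈ A`, and consistent with the elementary diagram of `M` (finitely satisfiable in `M`). -/
structure IsPhiType (φ : L.Formula (α ⊕ β)) (A : Set (β → M)) (p : Set ((L[[M]]).Formula α)) :
    Prop where
  form : ∀ θ ∈ p, ∃ a ∈ A, θ = withParams φ a ∨ θ = (withParams φ a).not
  complete : ∀ a ∈ A, withParams φ a ∈ p ∨ (withParams φ a).not ∈ p
  consistent : ∀ q ⊆ p, q.Finite → ∃ b : α → M, ∀ θ ∈ q, θ.Realize b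

/-- `ψ(y)`, possibly with parameters, defines the `φ`-type `p` over `A`. -/
def Defines (φ : L.Formula (α ⊕ β)) (A : Set (β → M)) (p : Set ((L[[M]]).Formula α))
    (ψ : (L[[M]]).Formula β) : Prop :=
  ∀ b ∈ A, ψ.Realize b ↔ withParams φ b ∈ p

/-- For `ψ(y, z)` with `z = (z_i : i < k)`, where every `z_i` is a tuple of variables like `y`, and
for `c = (c_i : i < k)` with `c_i` in `M ^ y`, the formula `ψ(y, c)`. -/
def withTuples {k : ℕ} (ψ : L.Formula (β ⊕ Fin k × β)) (c : Fin k → β → M) :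
    (L[[M]]).Formula β :=
  withParams ψ (fun r => c r.1 r.2)

end Types

section Shapes

variable {L : FirstOrder.Language.{u, v}} {α : Type u'} {β : Type v'}

/-- The power `φ ^ ε`: `φ ^ 0 = φ` and `φ ^ 1 = ¬ φ`. -/
def signed {γ : Type*} (θ : L.Formula γ) (ε : Fin 2) : L.Formula γ :=
  if ε = 0 then θ else θ.not

/-- The combinatorial data of one disjunct: `m ≤ K`, `s ⊆ m`, and for every `t < m` a set
`s_t ⊆ K` and signs `ε_{i,t} < 2` for `i ∈ s_t`. -/
structure Pattern (K : ℕ) where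
  m : ℕ
  m_le : m ≤ K
  s : Finset (Fin m)
  sub : Fin m → Finset (Fin K)
  sign : (t : Fin m) → {i // i ∈ sub t} → Fin 2

variable {K : ℕ}

/-- `φ(d_t, z_i)`, in the variables `y`, `z = (z_i : i < K)` and `d = (d_t : t < m)`. -/
def atZ (φ : L.Formula (α ⊕ β)) {m : ℕ} (t : Fin m) (i : Fin K) :
    L.Formula ((β ⊕ Fin K × β) ⊕ Fin m × α) :=
  φ.relabel (Sum.elim (fun j => Sum.inr (t, j)) (fun j => Sum.inl (Sum.inr (i, j))))

/-- `φ(d_t, y)`, in the variables `y`, `z = (z_i : i < K)` and `d = (d_t : t < m)`. -/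
def atY (φ : L.Formula (α ⊕ β)) {m : ℕ} (t : Fin m) :
    L.Formula ((β ⊕ Fin K × β) ⊕ Fin m × α) :=
  φ.relabel (Sum.elim (fun j => Sum.inr (t, j)) (fun j => Sum.inl (Sum.inl j)))

/-- `⋀_{t < m} ⋀_{i ∈ s_t} φ(d_t, z_i) ^ ε_{i,t}`. -/
noncomputable def Pattern.guard (P : Pattern K) (φ : L.Formula (α ⊕ β)) :
    L.Formula ((β ⊕ Fin K × β) ⊕ Fin P.m × α) :=
  FirstOrder.Language.Formula.iInf fun t : Fin P.m =>
    FirstOrder.Language.Formula.iInf fun i : {i // i ∈ P.sub t} => signed (atZ φ t i.1) (P.sign t i)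

/-- `⋀_{t ∈ s} φ(d_t, y)`. -/
noncomputable def Pattern.body (P : Pattern K) (φ : L.Formula (α ⊕ β)) :
    L.Formula ((β ⊕ Fin K × β) ⊕ Fin P.m × α) :=
  FirstOrder.Language.Formula.iInf fun t : {t // t ∈ P.s} => atY φ t.1

/-- `∃ d_0 … d_{m-1} (⋀_{t < m} ⋀_{i ∈ s_t} φ(d_t, z_i) ^ ε_{i,t} ∧ ⋀_{t ∈ s} φ(d_t, y))`. -/
noncomputable def Pattern.exFormula [Finite α] (P : Pattern K) (φ : L.Formula (α ⊕ β)) :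
    L.Formula (β ⊕ Fin K × β) :=
  FirstOrder.Language.Formula.iExs (Fin P.m × α) (P.guard φ ⊓ P.body φ)

/-- `∀ d_0 … d_{m-1} (⋀_{t < m} ⋀_{i ∈ s_t} φ(d_t, z_i) ^ ε_{i,t} → ⋀_{t ∈ s} φ(d_t, y))`. -/
noncomputable def Pattern.allFormula [Finite α] (P : Pattern K) (φ : L.Formula (α ⊕ β)) :
    L.Formula (β ⊕ Fin K × β) :=
  FirstOrder.Language.Formula.iAlls (Fin P.m × α) ((P.guard φ).imp (P.body φ))

end Shapes

section Conditions

variable {L : FirstOrder.Language.{u, v}} {α : Type u'} {β : Type v'}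

/-- `φ(x, y)` is NIP in `T` (models range over the universe `w`). -/
def IsNIP (T : L.Theory) (φ : L.Formula (α ⊕ β)) : Prop :=
  ∀ M : FirstOrder.Language.Theory.ModelType.{u, v, w} T,
    IsVCClass {B : Set (α → M) | ∃ a : β → M, B = solutionSet φ a}

/-- `φ(x, y)` has uniform definability of types over finite sets in `T`. -/
def HasUDTFS (T : L.Theory) (φ : L.Formula (α ⊕ β)) : Prop :=
  ∃ (k : ℕ) (ψ : L.Formula (β ⊕ Fin k × β)),
    ∀ (M : FirstOrder.Language.Theory.ModelType.{u, v, w} T) (A : Set (β → M)), A.Finite → 2 ≤ A.ncard →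
      ∀ p : Set ((L[[M]]).Formula α), IsPhiType φ A p →
        ∃ c : Fin k → β → M, (∀ i, c i ∈ A) ∧ Defines φ A p (withTuples ψ c)

/-- For some `K`, every `φ`-type over a finite nonempty set `A` in a model of `T` is defined by
`ψ(y, a)`, for some `a = (a_i : i < K)` from `A` and some finite disjunction `ψ(y, z)` of
formulas from the family `shape`, which is indexed by the patterns for `K`. -/
def HasUniformShape (T : L.Theory) (φ : L.Formula (α ⊕ β))
    (shape : (K : ℕ) → Pattern K → L.Formula (β ⊕ Fin K × β)) : Prop :=
  ∃ K : ℕ, ∀ (M : FirstOrder.Language.Theory.ModelType.{u, v, w} T) (A : Set (β → M)), A.Finite → A.Nonempty →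
    ∀ p : Set ((L[[M]]).Formula α), IsPhiType φ A p →
      ∃ (n : ℕ) (P : Fin n → Pattern K) (a : Fin K → β → M), (∀ i, a i ∈ A) ∧
        Defines φ A p (withTuples (FirstOrder.Language.Formula.iSup fun r => shape K (P r)) a)

/-- Uniform definability by finite disjunctions of existential formulas. -/
def HasExDefinitions [Finite α] (T : L.Theory) (φ : L.Formula (α ⊕ β)) : Prop :=
  HasUniformShape.{u, v, w} T φ (fun _ P => P.exFormula φ)

/-- Uniform definability by finite disjunctions of universal formulas. -/
def HasAllDefinitions [Finite α] (T : L.Theory) (φ : L.Formula (α ⊕ β)) : Prop :=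
  HasUniformShape.{u, v, w} T φ (fun _ P => P.allFormula φ)

end Conditions

end UDTFS

/-! The deep step is from NIP to definitions. By compactness, the dimension of an NIP formula is
bounded uniformly over the models of `T` (`IsNIP.exists_uniform_bound`), and the bound passes to the
dual family. Hence the traces φ(b, ·) on a finite set A form a finite family C of functions A → Bool
of bounded dimension.

The combinatorial core is `exists_majority_of_isolated`, the argument behind sample compression for
VC classes. By `exists_isolated`, nonempty families of bounded dimension have members determined
within the family by boundedly many values. Given p in C and a distribution μ on A,
`exists_sample_card_le` yields a bounded sample such that every member of C agreeing with p on it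
differs from p with μ-probability at most 1/3. An isolated member of the subfamily agreeing with p
on the sample is then isolated in C by boundedly many points. Minimax turns this into one
distribution on isolated members that errs with probability at most 1/3 at each point of A, and
sampling from it, in the dual family, leaves a majority vote of boundedly many members.

Such a vote is definable: one disjunct for each majority s of the voters, with guards fixing the
values at the isolating points. The guards determine the whole trace of each d_t on A and are
satisfiable, so quantifying d_t existentially or universally gives the same set.

For UDTFS, the finitely many patterns are switched on or off by equalities between extra parameters.
Conversely, UDTFS allows at most n^k types over n points, fewer than 2^n for suitable n, so the dual
dimension, and hence the dimension, is bounded. -/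

namespace UDTFS

/-! ### Shattered tuples, duality and the Sauer–Shelah bound -/

section Shattering

variable {ι X κ κ' : Type*}

/-- The tuple `x` is shattered by the family of subsets of `X` given by the relation `R`. -/
def ShattersTuple (R : ι → X → Prop) (x : κ → X) : Prop :=
  ∀ S : Set κ, ∃ i, ∀ j, R i (x j) ↔ j ∈ S

lemma ShattersTuple.injective {R : ι → X → Prop} {x : κ → X} (h : ShattersTuple R x) :
    Function.Injective x := by
  intro a b hab
  obtain ⟨i, hi⟩ := h {a}
  have h1 := (hi a).2 rfl
  rw [hab] at h1
  exact ((hi b).1 h1).symm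

lemma ShattersTuple.comp {R : ι → X → Prop} {x : κ → X} (h : ShattersTuple R x) {f : κ' → κ}
    (hf : Function.Injective f) : ShattersTuple R (x ∘ f) := by
  intro S
  obtain ⟨i, hi⟩ := h (f '' S)
  exact ⟨i, fun j => (hi (f j)).trans hf.mem_set_image⟩

/-- Among the points indexed by all subsets of κ, some member of the family picks out exactly those
whose index contains j. These members, one for each j, are shattered in the dual. This is the source
of the bound 2 ^ n for dual families. -/
lemma ShattersTuple.exists_flip {R : ι → X → Prop} {x : Set κ → X} (h : ShattersTuple R x) :
    ∃ y : κ → ι, ShattersTuple (flip R) y := by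
  choose y hy using fun j : κ => h {S | j ∈ S}
  exact ⟨y, fun S => ⟨x S, fun j => hy j S⟩⟩

lemma not_shattersTuple_flip {R : ι → X → Prop} {n : ℕ}
    (h : ∀ x : Fin n → X, ¬ ShattersTuple R x) (y : Fin (2 ^ n) → ι) :
    ¬ ShattersTuple (flip R) y := by
  intro hy
  let e : Set (Fin n) ≃ Fin (2 ^ n) := Fintype.equivFinOfCardEq (by simp)
  obtain ⟨x, hx⟩ := (hy.comp e.injective).exists_flip
  exact h x hx

lemma sum_range_pow_le (m n : ℕ) : ∑ k ∈ Finset.range n, m ^ k ≤ (m + 1) ^ n := by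
  rcases Nat.eq_zero_or_pos m with rfl | hm
  · rcases n with _ | n
    · simp
    · rw [Finset.sum_range_succ']; simp
  · induction n with
    | zero => simp
    | succ n ih =>
      rw [Finset.sum_range_succ, pow_succ (m + 1) n]
      have : m ^ n ≤ (m + 1) ^ n := Nat.pow_le_pow_left (by omega) n
      calc _ ≤ (m + 1) ^ n + m * (m + 1) ^ n := add_le_add ih (this.trans (Nat.le_mul_of_pos_left _ hm))
        _ = _ := by ring

/-- Sauer–Shelah bound for the number of traces on a finite tuple. -/
lemma card_traces_le [Fintype κ] {R : ι → X → Prop} {n : ℕ}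
    (h : ∀ x : Fin n → X, ¬ ShattersTuple R x) (x : κ → X) (𝒜 : Finset (Finset κ))
    (h𝒜 : ∀ s ∈ 𝒜, ∃ i, ∀ j, R i (x j) ↔ j ∈ s) : 𝒜.card ≤ (Fintype.card κ + 1) ^ n := by
  classical
  -- A set shattered by the traces has fewer than n points, since n of its points would form a
  -- shattered tuple. It remains to count such sets.
  have hsub : 𝒜.shatterer ⊆ (Finset.range n).biUnion fun k => Finset.powersetCard k Finset.univ := by
    intro s hs
    rw [Finset.mem_shatterer] at hs
    simp only [Finset.mem_biUnion, Finset.mem_range, Finset.mem_powersetCard, Finset.subset_univ,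
      true_and, exists_eq_right']
    by_contra! hn
    obtain ⟨t, hts, htn⟩ := Finset.exists_subset_card_eq hn
    have hsh : ShattersTuple R (fun j : t => x j) := by
      intro S
      obtain ⟨u, hu, hsu⟩ := (hs.mono_right hts)
        (t := Finset.univ.filter fun a => ∃ h : a ∈ t, (⟨a, h⟩ : t) ∈ S)
        (by intro a; simp only [Finset.mem_filter, Finset.mem_univ, true_and]; exact fun h => h.1)
      obtain ⟨i, hi⟩ := h𝒜 u hu
      refine ⟨i, fun j => (hi j).trans ?_⟩
      have := Finset.ext_iff.1 hsu j
      simpa using this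
    exact h _ (hsh.comp (t.equivFinOfCardEq htn).symm.injective)
  calc 𝒜.card ≤ 𝒜.shatterer.card := Finset.card_le_card_shatterer 𝒜
    _ ≤ _ := Finset.card_le_card hsub
    _ ≤ ∑ k ∈ Finset.range n, (Finset.powersetCard k (Finset.univ : Finset κ)).card :=
      Finset.card_biUnion_le
    _ ≤ ∑ k ∈ Finset.range n, Fintype.card κ ^ k := by
      refine Finset.sum_le_sum fun k _ => ?_
      rw [Finset.card_powersetCard, Finset.card_univ]
      exact Nat.choose_le_pow _ _
    _ ≤ _ := sum_range_pow_le _ _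

end Shattering

/-! ### Isolated members of families of bounded dimension -/

section Teaching

variable {X : Type*}

/-- The family of sets with indicator functions in `C`. -/
def evalRel (C : Finset (X → Bool)) (q : C) (x : X) : Prop := q.1 x = true

lemma ShattersTuple.exists_mem_filter {C : Finset (X → Bool)} {P : (X → Bool) → Prop}
    [DecidablePred P] {κ : Type*} {z : κ → X}
    (h : ShattersTuple (evalRel (C.filter P)) z) (f : κ → Bool) :
    ∃ q ∈ C, P q ∧ ∀ j, q (z j) = f j := by
  obtain ⟨⟨q, hq⟩, hqz⟩ := h {j | f j = true}
  rw [Finset.mem_filter] at hq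
  refine ⟨q, hq.1, hq.2, fun j => ?_⟩
  have := hqz j
  simp only [evalRel, Set.mem_ofPred_eq] at this
  exact Bool.eq_iff_iff.2 this

open Classical in
/-- A nonempty subfamily of `C` of least size among those cut out by prescribing values at boundedly
many points has smaller dimension than `C`. -/
lemma exists_restriction_not_shattersTuple [Fintype X] {C : Finset (X → Bool)} (hC : C.Nonempty)
    {d : ℕ} (hd : 1 ≤ d) (h : ∀ x : Fin (d + 1) → X, ¬ ShattersTuple (evalRel C) x) :
    ∃ p ∈ C, ∃ Y : Finset X, Y.card ≤ 2 ^ d * d + d ∧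
      ∀ z : Fin d → X, ¬ ShattersTuple (evalRel (C.filter fun q => ∀ y ∈ Y, q y = p y)) z := by
  let N : (X → Bool) × Finset X → ℕ := fun r => (C.filter fun q => ∀ y ∈ r.2, q y = r.1 y).card
  obtain ⟨⟨p, Y⟩, hpY, hmin⟩ := Finset.exists_min_image
    (C ×ˢ Finset.univ.filter fun Y : Finset X => Y.card ≤ 2 ^ d * d + d) N
    (hC.product ⟨∅, Finset.mem_filter.2 ⟨Finset.mem_univ _, Nat.zero_le _⟩⟩)
  replace hpY : p ∈ C ∧ Y.card ≤ 2 ^ d * d + d :=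
    ⟨(Finset.mem_product.1 hpY).1, (Finset.mem_filter.1 (Finset.mem_product.1 hpY).2).2⟩
  refine ⟨p, hpY.1, Y, hpY.2, fun z hz => ?_⟩
  -- restricting further along `z` is impossible
  have key : ∀ (Y' : Finset X) (q : X → Bool), q ∈ C → Y'.card ≤ 2 ^ d * d + d →
      ¬ ((∀ c ∈ C, (∀ y ∈ Y', c y = q y) → (∀ y ∈ Y, c y = p y)) ∧ ∀ j, z j ∈ Y') := by
    rintro Y' q hq hY' ⟨hsub, hzY⟩
    -- This c differs from q at every z j. It lies in the subfamily cut out by (p, Y) but not in the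
    -- one cut out by (q, Y'), which is therefore strictly smaller; `hd` supplies a point of z.
    obtain ⟨c, hcC, hcY, hcz⟩ := hz.exists_mem_filter (fun j => ! q (z j))
    have hlt : N (q, Y') < N (p, Y) := by
      refine Finset.card_lt_card ?_
      rw [Finset.ssubset_iff_of_subset]
      · refine ⟨c, Finset.mem_filter.2 ⟨hcC, hcY⟩, fun hc => ?_⟩
        have h1 := (Finset.mem_filter.1 hc).2 _ (hzY ⟨0, hd⟩)
        rw [hcz] at h1
        simp at h1
      · intro c hc
        rw [Finset.mem_filter] at hc ⊢
        exact ⟨hc.1, hsub c hc.1 hc.2⟩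
    exact absurd (hmin (q, Y') (Finset.mem_product.2 ⟨hq, Finset.mem_filter.2 ⟨Finset.mem_univ _, hY'⟩⟩))
      (not_le.2 hlt)
  have hzcard : (Finset.univ.image z).card ≤ d := by
    simpa using (Finset.card_image_le (s := (Finset.univ : Finset (Fin d))) (f := z))
  by_cases hsmall : Y.card ≤ 2 ^ d * d
  · refine key (Y ∪ Finset.univ.image z) p hpY.1 ((Finset.card_union_le _ _).trans (by omega))
      ⟨fun c _ hc y hy => hc y (Finset.mem_union_left _ hy), fun j => by simp⟩
  -- Otherwise Y has no room for z. Since i together with z is not shattered by C, while the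
  -- subfamily realizes every pattern on z with value p i at i, some pattern on z forces the value p
  -- i throughout C.
  · have hw : ∀ i : Y, ∃ w : Fin d → Bool, ∀ c ∈ C, (∀ j, c (z j) = w j) → c i = p i := by
      intro i
      by_contra! hcon
      refine h (Fin.cons i.1 z) fun S => ?_
      let w : Fin d → Bool := fun j => decide (j.succ ∈ S)
      by_cases hi : p i = true ↔ (0 : Fin (d + 1)) ∈ S
      · obtain ⟨c, hcC, hcY, hcz⟩ := hz.exists_mem_filter w
        refine ⟨⟨c, hcC⟩, Fin.cases ?_ fun j => ?_⟩
        · simpa [evalRel, hcY i.1 i.2] using hi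
        · simp [evalRel, hcz, w]
      · obtain ⟨c, hcC, hcz, hci⟩ := hcon w
        refine ⟨⟨c, hcC⟩, Fin.cases ?_ fun j => ?_⟩
        · simp only [evalRel, Fin.cons_zero]
          rw [Bool.eq_not.2 hci]
          by_cases h0 : (0 : Fin (d + 1)) ∈ S <;> simp_all
        · simp [evalRel, hcz, w]
    choose w hw using hw
    -- With 2 ^ d patterns and more than 2 ^ d * d points, one pattern forces the values at more
    -- than d points of Y. Prescribing it on z makes those points superfluous, so trading them for
    -- the at most d points of z stays within the bound.
    obtain ⟨w₀, -, hw₀⟩ := Finset.exists_lt_card_fiber_of_mul_lt_card_of_maps_to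
      (s := (Finset.univ : Finset Y)) (t := (Finset.univ : Finset (Fin d → Bool))) (f := w) (n := d)
      (fun _ _ => Finset.mem_univ _) (by simpa using hsmall)
    set F : Finset Y := Finset.univ.filter fun i => w i = w₀
    let F' : Finset X := F.map (Function.Embedding.subtype _)
    have hF'Y : F' ⊆ Y := by
      intro x hx
      obtain ⟨i, -, rfl⟩ := Finset.mem_map.1 hx
      exact i.2
    have hF'c : d < F'.card := by simpa [F'] using hw₀
    obtain ⟨q, hqC, hqY, hqz⟩ := hz.exists_mem_filter w₀
    refine key ((Y \ F') ∪ Finset.univ.image z) q hqC ?_ ⟨fun c hcC hc y hy => ?_, fun j => by simp⟩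
    · refine (Finset.card_union_le _ _).trans ?_
      have := Finset.card_sdiff_add_card_eq_card hF'Y
      omega
    · by_cases hyF : y ∈ F'
      · obtain ⟨i, hi, rfl⟩ := Finset.mem_map.1 hyF
        refine hw i c hcC fun j => ?_
        rw [(Finset.mem_filter.1 hi).2, ← hqz j]
        exact hc _ (Finset.mem_union_right _ (Finset.mem_image_of_mem _ (Finset.mem_univ j)))
      · rw [hc y (Finset.mem_union_left _ (Finset.mem_sdiff.2 ⟨hy, hyF⟩)), hqY y hy]

/-- A nonempty finite family of bounded dimension has a member isolated by boundedly many points. -/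
theorem exists_isolated (d : ℕ) : ∃ k : ℕ, ∀ {X : Type*} [Fintype X] (C : Finset (X → Bool)),
    C.Nonempty → (∀ x : Fin d → X, ¬ ShattersTuple (evalRel C) x) →
      ∃ q ∈ C, ∃ D : Finset X, D.card ≤ k ∧ ∀ c ∈ C, (∀ x ∈ D, c x = q x) → c = q := by
  classical
  -- The empty tuple is shattered by any nonempty family. The induction proper starts at d = 1,
  -- where the family is a singleton, because the restriction lemma needs d ≥ 1.
  rcases d with _ | d
  · refine ⟨0, fun C hC h => absurd ?_ (h Fin.elim0)⟩
    obtain ⟨q, hq⟩ := hC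
    exact fun S => ⟨⟨q, hq⟩, fun j => j.elim0⟩
  induction d with
  | zero =>
    refine ⟨0, fun C hC h => ?_⟩
    obtain ⟨q, hq⟩ := hC
    refine ⟨q, hq, ∅, by simp, fun c hc _ => ?_⟩
    by_contra hne
    obtain ⟨x, hx⟩ := Function.ne_iff.1 hne
    refine h (fun _ => x) fun S => ?_
    have hcq : c x = ! q x := Bool.eq_not.2 hx
    by_cases h0 : ((0 : Fin 1) ∈ S ↔ q x = true)
    · refine ⟨⟨q, hq⟩, fun j => ?_⟩
      rw [Fin.fin_one_eq_zero j, h0, evalRel]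
    · refine ⟨⟨c, hc⟩, fun j => ?_⟩
      rw [Fin.fin_one_eq_zero j]
      change c x = true ↔ _
      rw [hcq]
      by_cases hS : (0 : Fin 1) ∈ S <;> simp_all
  | succ d ih =>
    obtain ⟨k, hk⟩ := ih
    refine ⟨2 ^ (d + 1) * (d + 1) + (d + 1) + k, fun C hC h => ?_⟩
    obtain ⟨p, hp, Y, hY, hz⟩ := exists_restriction_not_shattersTuple hC (Nat.le_add_left 1 d) h
    obtain ⟨q, hq, D, hD, hiso⟩ := hk _ ⟨p, Finset.mem_filter.2 ⟨hp, fun _ _ => rfl⟩⟩ hz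
    rw [Finset.mem_filter] at hq
    refine ⟨q, hq.1, Y ∪ D, (Finset.card_union_le _ _).trans (by omega), fun c hc hcq => ?_⟩
    refine hiso c (Finset.mem_filter.2 ⟨hc, fun y hy => ?_⟩)
      fun x hx => hcq x (Finset.mem_union_right _ hx)
    rw [hcq y (Finset.mem_union_left _ hy), hq.2 y hy]

end Teaching
end UDTFS

namespace UDTFS

/-! ### Uniform approximation of measures by bounded samples -/

section Sampling

variable {ι X : Type*}

lemma prod_sum_eq_sum_prod [Fintype X] {κ : Type*} [Fintype κ] [DecidableEq κ]
    (g : κ → X → ℝ) :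
    ∏ j, ∑ y, g j y = ∑ x : κ → X, ∏ j, g j (x j) := by
  rw [Finset.prod_univ_sum, Fintype.piFinset_univ]

lemma exp_sub_avg_le [Fintype X] {μ : X → ℝ} (hμ : μ ∈ stdSimplex ℝ X) (g : X → ℝ) (a ε : ℝ) :
    Real.exp (ε * (a - ∑ y, μ y * g y)) ≤ ∑ y, μ y * Real.exp (ε * (a - g y)) := by
  have h := convexOn_exp.map_sum_le (t := Finset.univ) (w := μ) (p := fun y => ε * (a - g y))
    (fun y _ => hμ.1 y) hμ.2 (fun _ _ => Set.mem_univ _)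
  simp only [smul_eq_mul] at h
  refine le_trans (le_of_eq ?_) h
  congr 1
  have : ∑ y, μ y * (ε * (a - g y)) = ε * (a * ∑ y, μ y - ∑ y, μ y * g y) := by
    rw [Finset.mul_sum, ← Finset.sum_sub_distrib, Finset.mul_sum]
    exact Finset.sum_congr rfl fun y _ => by ring
  rw [this, hμ.2, mul_one]

/-- The sum over random signs of an exponential moment is subgaussian. -/
lemma sum_signs_exp_le {m : ℕ} (ε : ℝ) (d : Fin m → ℝ) (hd : ∀ j, |d j| ≤ 1) :
    ∑ σ : Fin m → Bool, Real.exp (ε * ∑ j, (if σ j then -d j else d j)) ≤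
      2 ^ m * Real.exp (m * (ε ^ 2 / 2)) := by
  have h1 : ∀ j, ∑ b : Bool, Real.exp (ε * (if b then -d j else d j)) ≤
      2 * Real.exp (ε ^ 2 / 2) := by
    intro j
    have h2 := Real.cosh_le_exp_half_sq (ε * d j)
    rw [Real.cosh_eq] at h2
    have h3 : (ε * d j) ^ 2 ≤ ε ^ 2 := by
      rw [mul_pow]
      exact mul_le_of_le_one_right (sq_nonneg _) ((sq_le_one_iff_abs_le_one _).2 (hd j))
    have h4 : Real.exp ((ε * d j) ^ 2 / 2) ≤ Real.exp (ε ^ 2 / 2) := by gcongr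
    simp only [Fintype.sum_bool, if_true, Bool.false_eq_true, if_false, mul_neg]
    linarith
  calc _ = ∑ σ : Fin m → Bool, ∏ j, Real.exp (ε * (if σ j then -d j else d j)) := by
        refine Finset.sum_congr rfl fun σ _ => ?_
        rw [Finset.mul_sum, Real.exp_sum]
    _ = ∏ j, ∑ b : Bool, Real.exp (ε * (if b then -d j else d j)) :=
        (prod_sum_eq_sum_prod fun j (b : Bool) => Real.exp (ε * (if b then -d j else d j))).symm
    _ ≤ ∏ _j : Fin m, (2 * Real.exp (ε ^ 2 / 2)) :=
        Finset.prod_le_prod (fun j _ => Finset.sum_nonneg fun _ _ => (Real.exp_pos _).le)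
          fun j _ => h1 j
    _ = _ := by
        rw [Finset.prod_const, Finset.card_univ, Fintype.card_fin, mul_pow, ← Real.exp_nat_mul]

/-- Exchange the two entries of the pairs in a sample of pairs where `σ` holds. -/
def swapPairs {m : ℕ} (σ : Fin m → Bool) (z : Fin m → X × X) : Fin m → X × X :=
  fun j => if σ j then (z j).swap else z j

lemma swapPairs_involutive {m : ℕ} (σ : Fin m → Bool) :
    Function.Involutive (swapPairs (X := X) σ) := by
  intro z
  funext j
  by_cases h : σ j <;> simp [swapPairs, h]

open Classical in
/-- The vectors of differences of the functions `f i` along a sample of pairs. -/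
noncomputable def differences [Fintype ι] (f : ι → X → ℝ) {m : ℕ} (z : Fin m → X × X) :
    Finset (Fin m → ℝ) :=
  Finset.univ.image fun i j => f i (z j).1 - f i (z j).2

lemma sum_differences_swapPairs [Fintype ι] (f : ι → X → ℝ) {m : ℕ} (σ : Fin m → Bool)
    (z : Fin m → X × X) (g : (Fin m → ℝ) → ℝ) :
    ∑ d ∈ differences f (swapPairs σ z), g d =
      ∑ d ∈ differences f z, g fun j => if σ j then -d j else d j := by
  classical
  have h : differences f (swapPairs σ z) =
      (differences f z).image fun d j => if σ j then -d j else d j := by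
    rw [differences, differences, Finset.image_image]
    refine Finset.image_congr fun i _ => ?_
    funext j
    by_cases h : σ j <;> simp [swapPairs, h]
  rw [h, Finset.sum_image]
  intro d _ d' _ hdd
  funext j
  have := congrFun hdd j
  by_cases h : σ j <;> simpa [h] using this

/-- Symmetrization: some sample does not overestimate any of the functions by more than `ε`. -/
theorem exists_sample_sum_le [Fintype ι] [Fintype X] (f : ι → X → ℝ)
    (hf : ∀ i x, f i x ∈ Set.Icc (0 : ℝ) 1) {μ : X → ℝ} (hμ : μ ∈ stdSimplex ℝ X) {m : ℕ} {ε G : ℝ}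
    (hε : 0 < ε) (hG : ∀ z : Fin m → X × X, ((differences f z).card : ℝ) ≤ G)
    (hm : G < Real.exp (m * (ε ^ 2 / 2))) :
    ∃ x : Fin m → X, ∀ i, ∑ j, f i (x j) ≤ m * (∑ y, μ y * f i y + ε) := by
  by_contra! hcon
  let W : (Fin m → X × X) → ℝ := fun z => ∏ j, (μ (z j).1 * μ (z j).2)
  have hW0 : ∀ z, 0 ≤ W z := fun z => Finset.prod_nonneg fun j _ => mul_nonneg (hμ.1 _) (hμ.1 _)
  have hW1 : ∑ z, W z = 1 := by
    have h := prod_sum_eq_sum_prod (κ := Fin m) (fun _ (y : X × X) => μ y.1 * μ y.2)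
    rw [show ∑ z, W z = _ from h.symm]
    simp [Fintype.sum_prod_type, ← Finset.mul_sum, hμ.2]
  have hWs : ∀ σ z, W (swapPairs σ z) = W z := by
    intro σ z
    refine Finset.prod_congr rfl fun j _ => ?_
    by_cases h : σ j <;> simp [swapPairs, h, mul_comm]
  -- Summing over distinct difference vectors, not over ι, makes the bound depend on G alone. At
  -- rate ε an excess of m * ε contributes exp(m ε²), while random signs allow only exp(m ε²/2) per
  -- vector; G is too small to close the gap.
  let Φ : (Fin m → X × X) → ℝ := fun z => ∑ d ∈ differences f z, Real.exp (ε * ∑ j, d j)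
  have hdiff : ∀ z : Fin m → X × X, ∀ d ∈ differences f z, ∀ j, |d j| ≤ 1 := by
    intro z d hd j
    obtain ⟨i, -, rfl⟩ := Finset.mem_image.1 hd
    have h1 := hf i (z j).1
    have h2 := hf i (z j).2
    rw [Set.mem_Icc] at h1 h2
    exact abs_le.2 ⟨by linarith, by linarith⟩
  have hexp : 0 < Real.exp (m * (ε ^ 2 / 2)) := Real.exp_pos _
  -- upper bound, averaging over all exchanges
  have hupper : ∑ z, W z * Φ z ≤ G * Real.exp (m * (ε ^ 2 / 2)) := by
    have hinv : ∀ σ : Fin m → Bool, ∑ z, W z * Φ z = ∑ z, W z * Φ (swapPairs σ z) := by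
      intro σ
      rw [← (Equiv.sum_comp (swapPairs_involutive (X := X) σ).toPerm fun z => W z * Φ z)]
      refine Finset.sum_congr rfl fun z _ => ?_
      simp only [Function.Involutive.coe_toPerm, hWs]
    have hsum : (2 : ℝ) ^ m * ∑ z, W z * Φ z = ∑ z, W z * ∑ σ, Φ (swapPairs σ z) := by
      calc (2 : ℝ) ^ m * ∑ z, W z * Φ z = ∑ _σ : Fin m → Bool, ∑ z, W z * Φ z := by simp
        _ = ∑ σ : Fin m → Bool, ∑ z, W z * Φ (swapPairs σ z) :=
            Finset.sum_congr rfl fun σ _ => hinv σ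
        _ = _ := by
            rw [Finset.sum_comm]
            exact Finset.sum_congr rfl fun z _ => (Finset.mul_sum _ _ _).symm
    have hΦ : ∀ z, ∑ σ, Φ (swapPairs σ z) ≤ G * (2 ^ m * Real.exp (m * (ε ^ 2 / 2))) := by
      intro z
      calc ∑ σ, Φ (swapPairs σ z) = ∑ σ : Fin m → Bool, ∑ d ∈ differences f z,
              Real.exp (ε * ∑ j, (if σ j then -d j else d j)) :=
            Finset.sum_congr rfl fun σ _ =>
              sum_differences_swapPairs f σ z fun d => Real.exp (ε * ∑ j, d j)
        _ = ∑ d ∈ differences f z, ∑ σ : Fin m → Bool,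
              Real.exp (ε * ∑ j, (if σ j then -d j else d j)) := Finset.sum_comm
        _ ≤ ∑ _d ∈ differences f z, 2 ^ m * Real.exp (m * (ε ^ 2 / 2)) :=
            Finset.sum_le_sum fun d hd => sum_signs_exp_le ε d (hdiff z d hd)
        _ = (differences f z).card * (2 ^ m * Real.exp (m * (ε ^ 2 / 2))) := by
            rw [Finset.sum_const, nsmul_eq_mul]
        _ ≤ _ := by gcongr; exact hG z
    have h2 : (2 : ℝ) ^ m * ∑ z, W z * Φ z ≤ 2 ^ m * (G * Real.exp (m * (ε ^ 2 / 2))) := by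
      rw [hsum]
      calc _ ≤ ∑ z, W z * (G * (2 ^ m * Real.exp (m * (ε ^ 2 / 2)))) :=
            Finset.sum_le_sum fun z _ => mul_le_mul_of_nonneg_left (hΦ z) (hW0 z)
        _ = _ := by rw [← Finset.sum_mul, hW1]; ring
    exact le_of_mul_le_mul_left h2 (by positivity)
  -- lower bound, from Jensen's inequality
  have hlower : Real.exp (m * ε ^ 2) ≤ ∑ z, W z * Φ z := by
    have hx : ∀ x : Fin m → X, Real.exp (m * ε ^ 2) ≤
        ∑ x' : Fin m → X, (∏ j, μ (x' j)) * Φ fun j => (x j, x' j) := by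
      intro x
      obtain ⟨i, hi⟩ := hcon x
      calc Real.exp (m * ε ^ 2) ≤ Real.exp (∑ j, ε * (f i (x j) - ∑ y, μ y * f i y)) := by
            apply Real.exp_le_exp.2
            rw [← Finset.mul_sum, Finset.sum_sub_distrib, Finset.sum_const, Finset.card_univ,
              Fintype.card_fin, nsmul_eq_mul]
            nlinarith
        _ = ∏ j, Real.exp (ε * (f i (x j) - ∑ y, μ y * f i y)) := Real.exp_sum _ _
        _ ≤ ∏ j, ∑ y, μ y * Real.exp (ε * (f i (x j) - f i y)) :=
            Finset.prod_le_prod (fun _ _ => (Real.exp_pos _).le)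
              fun j _ => exp_sub_avg_le hμ _ _ _
        _ = ∑ x' : Fin m → X, ∏ j, (μ (x' j) * Real.exp (ε * (f i (x j) - f i (x' j)))) :=
            prod_sum_eq_sum_prod fun j y => μ y * Real.exp (ε * (f i (x j) - f i y))
        _ ≤ _ := by
            refine Finset.sum_le_sum fun x' _ => ?_
            rw [Finset.prod_mul_distrib, ← Real.exp_sum, ← Finset.mul_sum]
            refine mul_le_mul_of_nonneg_left ?_ (Finset.prod_nonneg fun j _ => hμ.1 _)
            exact Finset.single_le_sum
              (f := fun d : Fin m → ℝ => Real.exp (ε * ∑ j, d j))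
              (fun _ _ => (Real.exp_pos _).le)
              (Finset.mem_image_of_mem (fun i j => f i (x j) - f i (x' j)) (Finset.mem_univ i))
    have hμ1 : ∑ x : Fin m → X, ∏ j, μ (x j) = 1 := by
      rw [← prod_sum_eq_sum_prod fun (_ : Fin m) y => μ y]
      simp [hμ.2]
    have hsplit : ∑ z, W z * Φ z = ∑ x : Fin m → X, (∏ j, μ (x j)) *
        ∑ x' : Fin m → X, (∏ j, μ (x' j)) * Φ fun j => (x j, x' j) := by
      rw [← (Equiv.arrowProdEquivProdArrow (Fin m) (fun _ => X) (fun _ => X)).symm.sum_comp,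
        Fintype.sum_prod_type]
      refine Finset.sum_congr rfl fun x _ => ?_
      rw [Finset.mul_sum]
      refine Finset.sum_congr rfl fun x' _ => ?_
      rw [← mul_assoc, ← Finset.prod_mul_distrib]
      rfl
    rw [hsplit]
    calc Real.exp (m * ε ^ 2) = ∑ x : Fin m → X, (∏ j, μ (x j)) * Real.exp (m * ε ^ 2) := by
          rw [← Finset.sum_mul, hμ1, one_mul]
      _ ≤ _ := Finset.sum_le_sum fun x _ =>
          mul_le_mul_of_nonneg_left (hx x) (Finset.prod_nonneg fun j _ => hμ.1 _)
  have hsq : Real.exp (m * ε ^ 2) = Real.exp (m * (ε ^ 2 / 2)) * Real.exp (m * (ε ^ 2 / 2)) := by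
    rw [← Real.exp_add]; congr 1; ring
  have := hlower.trans hupper
  rw [hsq] at this
  exact absurd (le_of_mul_le_mul_right this hexp) (not_le.2 hm)

lemma exists_pow_lt_exp (n : ℕ) {c : ℝ} (hc : 0 < c) :
    ∃ m : ℕ, 0 < m ∧ ((2 * m + 1 : ℕ) : ℝ) ^ n < Real.exp (m * c) := by
  have h := (isLittleO_pow_exp_pos_mul_atTop n hc).comp_tendsto
    (tendsto_natCast_atTop_atTop (R := ℝ))
  -- The factor 3 ^ n absorbs 2m + 1 ≤ 3m, and the extra half makes the final inequality strict.
  have h3 : (0 : ℝ) < (1 / 3 ^ n) / 2 := by positivity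
  obtain ⟨m, hm, hm0⟩ := ((h.def h3).and (Filter.eventually_gt_atTop 0)).exists
  refine ⟨m, hm0, ?_⟩
  simp only [Function.comp_apply, norm_pow, Real.norm_eq_abs, Real.abs_exp, Nat.abs_cast] at hm
  have h1 : ((2 * m + 1 : ℕ) : ℝ) ≤ 3 * m := by
    have : (1 : ℝ) ≤ m := by exact_mod_cast hm0
    push_cast; linarith
  calc ((2 * m + 1 : ℕ) : ℝ) ^ n ≤ (3 * m) ^ n := by gcongr
    _ = 3 ^ n * (m : ℝ) ^ n := mul_pow _ _ _
    _ ≤ 3 ^ n * ((1 / 3 ^ n) / 2 * Real.exp (c * m)) := by gcongr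
    _ = Real.exp (m * c) / 2 := by rw [mul_comm c]; field_simp
    _ < _ := half_lt_self (Real.exp_pos _)

/-- The differences along m pairs are determined by the trace on the 2m points involved, and
Sauer–Shelah bounds the number of traces. -/
lemma card_differences_le [Fintype ι] {R : ι → X → Prop} [∀ i, DecidablePred (R i)] {n : ℕ}
    (h : ∀ x : Fin n → X, ¬ ShattersTuple R x) {m : ℕ} (z : Fin m → X × X) :
    (differences (fun i x => if R i x then 1 else 0) z).card ≤ (2 * m + 1) ^ n := by
  classical
  let x : Fin m ⊕ Fin m → X := Sum.elim (fun j => (z j).1) (fun j => (z j).2)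
  let 𝒜 : Finset (Finset (Fin m ⊕ Fin m)) :=
    Finset.univ.image fun i => Finset.univ.filter fun j => R i (x j)
  have h1 := card_traces_le h x 𝒜 fun s hs => by
    obtain ⟨i, -, rfl⟩ := Finset.mem_image.1 hs
    exact ⟨i, fun j => by simp⟩
  rw [Fintype.card_sum, Fintype.card_fin, ← two_mul] at h1
  refine (le_trans (Finset.card_le_card ?_) (Finset.card_image_le (s := 𝒜)
    (f := fun (s : Finset (Fin m ⊕ Fin m)) (j : Fin m) =>
      ((if Sum.inl j ∈ s then 1 else 0) - (if Sum.inr j ∈ s then 1 else 0) : ℝ)))).trans h1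
  intro d hd
  obtain ⟨i, -, rfl⟩ := Finset.mem_image.1 hd
  refine Finset.mem_image.2 ⟨_, Finset.mem_image_of_mem _ (Finset.mem_univ i), ?_⟩
  funext j; simp [x]

/-- One-sided uniform law of large numbers for families of bounded dimension. -/
theorem exists_sample_card_le (n : ℕ) {ε : ℝ} (hε : 0 < ε) :
    ∃ m : ℕ, 0 < m ∧ ∀ {ι X : Type*} [Fintype ι] [Fintype X] (R : ι → X → Prop)
      [∀ i, DecidablePred (R i)],
      (∀ x : Fin n → X, ¬ ShattersTuple R x) → ∀ μ ∈ stdSimplex ℝ X, ∃ x : Fin m → X, ∀ i,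
        ((Finset.univ.filter fun j => R i (x j)).card : ℝ) ≤
          m * (∑ y, μ y * (if R i y then 1 else 0) + ε) := by
  obtain ⟨m, hm0, hm⟩ := exists_pow_lt_exp n (c := ε ^ 2 / 2) (by positivity)
  refine ⟨m, hm0, fun R _ hR μ hμ => ?_⟩
  obtain ⟨x, hx⟩ := exists_sample_sum_le (fun i x => if R i x then (1 : ℝ) else 0)
    (fun i x => by split_ifs <;> simp) hμ hε
    (fun z => by exact_mod_cast card_differences_le hR z) hm
  exact ⟨x, fun i => by simpa using hx i⟩

end Sampling

/-! ### Minimax and majority votes of isolated members -/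

/-- Von Neumann's minimax theorem, for finite games. -/
theorem exists_mixed_strategy {H X : Type*} [Fintype H] [Fintype X] [Nonempty X] (l : H → X → ℝ)
    (c : ℝ) (h : ∀ μ ∈ stdSimplex ℝ X, ∃ i, ∑ x, μ x * l i x ≤ c) :
    ∃ ν ∈ stdSimplex ℝ H, ∀ x, ∑ i, ν i * l i x ≤ c := by
  classical
  obtain ⟨x₀⟩ := ‹Nonempty X›
  have hX : (stdSimplex ℝ X).Nonempty := ⟨_, single_mem_stdSimplex ℝ x₀⟩
  obtain ⟨i₀, -⟩ := h _ hX.some_mem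
  have hH : (stdSimplex ℝ H).Nonempty := ⟨_, single_mem_stdSimplex ℝ i₀⟩
  let f : (H → ℝ) →ₗ[ℝ] (X → ℝ) →ₗ[ℝ] ℝ :=
    ∑ i, ∑ x, l i x • (LinearMap.mul ℝ ℝ).compl₁₂ (LinearMap.proj i) (LinearMap.proj x)
  have hf : ∀ ν μ, f ν μ = ∑ i, ∑ x, l i x * (ν i * μ x) := by
    intro ν μ
    simp [f]
  obtain ⟨ν, hν, μ, hμ, hs⟩ := Sion.exists_isSaddlePointOn (f := fun ν μ => f ν μ) hH
    (convex_stdSimplex ℝ H) (isCompact_stdSimplex ℝ H)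
    (fun μ _ => ((f.flip μ).continuous_of_finiteDimensional).continuousOn.lowerSemicontinuousOn)
    (fun μ _ => ((f.flip μ).convexOn (convex_stdSimplex ℝ H)).quasiconvexOn)
    (convex_stdSimplex ℝ X) hX (isCompact_stdSimplex ℝ X)
    (fun ν _ => ((f ν).continuous_of_finiteDimensional).continuousOn.upperSemicontinuousOn)
    (fun ν _ => ((f ν).concaveOn (convex_stdSimplex ℝ X)).quasiconcaveOn)
  refine ⟨ν, hν, fun x => ?_⟩
  obtain ⟨i, hi⟩ := h μ hμ
  -- At the saddle point, ν against the pure strategy x costs at most what the pure reply i costs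
  -- against μ.
  have := hs _ (single_mem_stdSimplex ℝ i) _ (single_mem_stdSimplex ℝ x)
  simp only [hf] at this
  have e1 : ∑ i, ∑ y, l i y * (ν i * (Pi.single x 1 : X → ℝ) y) = ∑ i, ν i * l i x := by
    simp [Pi.single_apply, mul_comm]
  have e2 : ∑ j, ∑ y, l j y * ((Pi.single i 1 : H → ℝ) j * μ y) = ∑ y, μ y * l i y := by
    rw [Finset.sum_comm]
    simp [Pi.single_apply, mul_comm]
  rw [e1, e2] at this
  exact this.trans hi

/-- Comparison with a fixed set permutes the subsets of the index set, so it cannot raise the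
dimension. This covers agreement with p, disagreement with p, and passage to a subfamily. -/
lemma ShattersTuple.of_iff {ι ι' X κ : Type*} {R : ι → X → Prop} {R' : ι' → X → Prop} {P : X → Prop}
    (g : ι' → ι) (h : ∀ i x, R' i x ↔ (R (g i) x ↔ P x)) {x : κ → X} (hx : ShattersTuple R' x) :
    ShattersTuple R x := by
  intro S
  obtain ⟨i, hi⟩ := hx {j | j ∈ S ↔ P (x j)}
  refine ⟨g i, fun j => ?_⟩
  have := hi j
  rw [h, Set.mem_ofPred_eq] at this
  tauto

/-- Every member of a family of bounded dimension on a finite set is the majority vote of boundedly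
many members, each of which is isolated in the family by its values at boundedly many points. -/
theorem exists_majority_of_isolated (n : ℕ) : ∃ k m : ℕ, ∀ {X : Type*} [Fintype X] [Nonempty X]
    (C : Finset (X → Bool)), (∀ x : Fin n → X, ¬ ShattersTuple (evalRel C) x) → ∀ p ∈ C,
      ∃ (q : Fin m → X → Bool) (D : Fin m → Finset X),
        (∀ t, q t ∈ C ∧ (D t).card ≤ k ∧ ∀ c ∈ C, (∀ x ∈ D t, c x = q t x) → c = q t) ∧
        ∀ x, p x = true ↔ m < 2 * (Finset.univ.filter fun t => q t x = true).card := by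
  classical
  obtain ⟨k, hk⟩ := exists_isolated n
  -- The tolerances 1/3 here and 1/7 below satisfy 1/3 + 1/7 < 1/2, so fewer than half of the final
  -- voters err at any point.
  obtain ⟨m₁, hm₁, hnet⟩ := exists_sample_card_le n (ε := 1 / 3) (by norm_num)
  obtain ⟨m, hm, happrox⟩ := exists_sample_card_le (2 ^ n) (ε := 1 / 7) (by norm_num)
  refine ⟨m₁ + k, m, fun {X} _ _ C hC p hp => ?_⟩
  let H : Finset (X → Bool) := C.filter fun q => ∃ D : Finset X, D.card ≤ m₁ + k ∧
    ∀ c ∈ C, (∀ x ∈ D, c x = q x) → c = q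
  have hstrat : ∀ μ ∈ stdSimplex ℝ X, ∃ q : H, ∑ x, μ x * (if q.1 x ≠ p x then 1 else 0) ≤
      (1 / 3 : ℝ) := by
    intro μ hμ
    -- The sampled relation is agreement with p: a q agreeing with p on the whole sample N must
    -- agree with p on measure at least 2/3.
    obtain ⟨N, hN⟩ := hnet (fun (q : C) x => q.1 x = p x)
      (fun x hx => hC x (hx.of_iff (P := fun x => p x = true) id fun q x => Bool.eq_iff_iff)) μ hμ
    obtain ⟨q, hq, D, hD, hiso⟩ := hk (C.filter fun q => ∀ j, q (N j) = p (N j))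
      ⟨p, Finset.mem_filter.2 ⟨hp, fun _ => rfl⟩⟩
      (fun x hx => hC x (hx.of_iff (P := fun _ => True)
        (fun q => ⟨q.1, (Finset.mem_filter.1 q.2).1⟩) fun q x => by simp [evalRel]))
    rw [Finset.mem_filter] at hq
    refine ⟨⟨q, Finset.mem_filter.2 ⟨hq.1, D ∪ Finset.univ.image N, ?_, fun c hc hcq => ?_⟩⟩, ?_⟩
    · have := Finset.card_image_le (s := (Finset.univ : Finset (Fin m₁))) (f := N)
      rw [Finset.card_univ, Fintype.card_fin] at this
      exact (Finset.card_union_le _ _).trans (by omega)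
    · refine hiso c (Finset.mem_filter.2 ⟨hc, fun j => ?_⟩)
        fun x hx => hcq x (Finset.mem_union_left _ hx)
      rw [← hq.2 j]
      exact hcq _ (Finset.mem_union_right _ (Finset.mem_image_of_mem _ (Finset.mem_univ j)))
    · have h1 := hN ⟨q, hq.1⟩
      simp only at h1
      rw [Finset.filter_true_of_mem fun j _ => hq.2 j, Finset.card_univ, Fintype.card_fin] at h1
      have h2 : ∑ x, μ x * (if q x = p x then 1 else 0) + ∑ x, μ x * (if q x ≠ p x then 1 else 0) =
          (1 : ℝ) := by
        rw [← Finset.sum_add_distrib]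
        refine (Finset.sum_congr rfl fun x _ => ?_).trans hμ.2
        by_cases h : q x = p x <;> simp [h]
      have h3 : (0 : ℝ) < m₁ := by exact_mod_cast hm₁
      have h4 : 1 ≤ ∑ x, μ x * (if q x = p x then 1 else 0) + (1 / 3 : ℝ) := by
        by_contra! hlt
        nlinarith
      simp only at h2 ⊢
      linarith
  obtain ⟨ν, hν, herr⟩ := exists_mixed_strategy _ _ hstrat
  obtain ⟨q, hq⟩ := happrox (fun x (q : H) => q.1 x ≠ p x)
    (not_shattersTuple_flip (R := fun (q : H) x => q.1 x ≠ p x) fun x hx => hC x (hx.of_iff (P := fun x => ¬ p x = true)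
      (fun q => ⟨q.1, (Finset.mem_filter.1 q.2).1⟩) fun q x => by
        rw [evalRel, ne_eq, Bool.eq_iff_iff]; tauto)) ν hν
  choose D hD hiso using fun t => (Finset.mem_filter.1 (q t).2).2
  refine ⟨fun t => (q t).1, D,
    fun t => ⟨(Finset.mem_filter.1 (q t).2).1, hD t, hiso t⟩, fun x => ?_⟩
  have hx := hq x
  have hm' : (0 : ℝ) < m := by exact_mod_cast hm
  have hbad : 2 * (Finset.univ.filter fun t => (q t).1 x ≠ p x).card < m := by
    have h1 := herr x
    have : (2 * (Finset.univ.filter fun t => (q t).1 x ≠ p x).card : ℝ) < m := by nlinarith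
    exact_mod_cast this
  have hsplit := Finset.card_filter_add_card_filter_not (s := (Finset.univ : Finset (Fin m)))
    (fun t => (q t).1 x = true)
  rw [Finset.card_univ, Fintype.card_fin] at hsplit
  cases hpx : p x
  · simp only [hpx, ne_eq, Bool.not_eq_false] at hbad
    simp only [Bool.false_eq_true, false_iff, not_lt]
    omega
  · simp only [hpx, ne_eq] at hbad
    simp only [true_iff]
    omega

end UDTFS

namespace UDTFS

/-! ### Realization of types and of the prescribed formulas -/

section Semantics

variable {L : FirstOrder.Language.{u, v}} {α : Type u'} {β : Type v'} {M : Type w} [L.Structure M]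

lemma realize_withParams (θ : L.Formula (α ⊕ β)) (c : β → M) (b : α → M) :
    (withParams θ c).Realize b ↔ θ.Realize (Sum.elim b c) := by
  rw [withParams, FirstOrder.Language.Formula.Realize,
    FirstOrder.Language.BoundedFormula.realize_subst]
  have : (fun a => FirstOrder.Language.Term.realize b ((Sum.elim
      (fun i => FirstOrder.Language.Term.var i) (fun j => (L.con (c j)).term) :
        α ⊕ β → (L[[M]]).Term α) a)) = Sum.elim b c := by
    funext a
    rcases a with a | a
    · simp
    · simp only [Sum.elim_inr, FirstOrder.Language.Term.realize_constants]
      rfl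
  rw [this]
  exact FirstOrder.Language.LHom.realize_onFormula _ θ

lemma realize_withTuples {k : ℕ} (ψ : L.Formula (β ⊕ Fin k × β)) (c : Fin k → β → M) (y : β → M) :
    (withTuples ψ c).Realize y ↔ ψ.Realize (Sum.elim y fun r => c r.1 r.2) :=
  realize_withParams _ _ _

/-- The relation on `M ^ x × M ^ y` given by `φ`. -/
def rel (φ : L.Formula (α ⊕ β)) (b : α → M) (a : β → M) : Prop := φ.Realize (Sum.elim b a)

/-- Over a finite A the type is itself a finite set of formulas, so finite satisfiability realizes
all of it in M. -/
lemma IsPhiType.exists_realization {φ : L.Formula (α ⊕ β)} {A : Set (β → M)}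
    {p : Set ((L[[M]]).Formula α)} (hA : A.Finite) (hp : IsPhiType φ A p) :
    ∃ b : α → M, ∀ a ∈ A, withParams φ a ∈ p ↔ rel φ b a := by
  have hfin : p.Finite := by
    refine ((hA.image (withParams φ)).union (hA.image fun a => (withParams φ a).not)).subset ?_
    intro θ hθ
    obtain ⟨a, ha, rfl | rfl⟩ := hp.form θ hθ
    · exact Or.inl ⟨a, ha, rfl⟩
    · exact Or.inr ⟨a, ha, rfl⟩
  obtain ⟨b, hb⟩ := hp.consistent p subset_rfl hfin
  refine ⟨b, fun a ha => ⟨fun h => (realize_withParams φ a b).1 (hb _ h), fun h => ?_⟩⟩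
  refine (hp.complete a ha).resolve_right fun hn => ?_
  have := hb _ hn
  rw [FirstOrder.Language.Formula.realize_not, realize_withParams] at this
  exact this h

lemma exists_isPhiType (φ : L.Formula (α ⊕ β)) (A : Set (β → M)) (b : α → M) :
    ∃ p : Set ((L[[M]]).Formula α), IsPhiType φ A p ∧
      ∀ a ∈ A, withParams φ a ∈ p ↔ rel φ b a := by
  refine ⟨{θ | (∃ a ∈ A, θ = withParams φ a ∨ θ = (withParams φ a).not) ∧ θ.Realize b},
    ⟨fun θ hθ => hθ.1, fun a ha => ?_, fun q hq _ => ⟨b, fun θ hθ => (hq hθ).2⟩⟩, fun a ha => ?_⟩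
  · by_cases h : (withParams φ a).Realize b
    · exact Or.inl ⟨⟨a, ha, Or.inl rfl⟩, h⟩
    · exact Or.inr ⟨⟨a, ha, Or.inr rfl⟩, FirstOrder.Language.Formula.realize_not.2 h⟩
  · rw [rel, ← realize_withParams]
    exact ⟨fun h => h.2, fun h => ⟨⟨a, ha, Or.inl rfl⟩, h⟩⟩

lemma realize_signed {γ : Type*} (θ : L.Formula γ) (ε : Fin 2) (x : γ → M) :
    (signed θ ε).Realize x ↔ (θ.Realize x ↔ ε = 0) := by
  unfold signed
  split_ifs with h <;> simp [h]

variable {K : ℕ} (P : Pattern K) (φ : L.Formula (α ⊕ β)) (y : β → M) (z : Fin K → β → M)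

/-- The tuple `d` satisfies the sign conditions of the pattern on the parameters `z`. -/
def Pattern.Guards (d : Fin P.m → α → M) : Prop :=
  ∀ t, ∀ i : {i // i ∈ P.sub t}, rel φ (d t) (z i) ↔ P.sign t i = 0

lemma realize_guard (d : Fin P.m × α → M) :
    (P.guard φ).Realize (Sum.elim (Sum.elim y fun r => z r.1 r.2) d) ↔
      P.Guards φ z fun t j => d (t, j) := by
  simp only [Pattern.guard, FirstOrder.Language.Formula.realize_iInf, realize_signed, atZ,
    FirstOrder.Language.Formula.realize_relabel, Pattern.Guards, rel]
  refine forall_congr' fun t => forall_congr' fun i => ?_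
  congr! 2
  funext a
  rcases a with a | a <;> rfl

lemma realize_body (d : Fin P.m × α → M) :
    (P.body φ).Realize (Sum.elim (Sum.elim y fun r => z r.1 r.2) d) ↔
      ∀ t ∈ P.s, rel φ (fun j => d (t, j)) y := by
  simp only [Pattern.body, FirstOrder.Language.Formula.realize_iInf, atY,
    FirstOrder.Language.Formula.realize_relabel, rel, Subtype.forall]
  refine forall_congr' fun t => forall_congr' fun _ => ?_
  congr! 1
  funext a
  rcases a with a | a <;> rfl

lemma realize_exFormula [Finite α] :
    (P.exFormula φ).Realize (Sum.elim y fun r => z r.1 r.2) ↔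
      ∃ d : Fin P.m → α → M, P.Guards φ z d ∧ ∀ t ∈ P.s, rel φ (d t) y := by
  simp only [Pattern.exFormula, FirstOrder.Language.Formula.realize_iExs,
    FirstOrder.Language.Formula.realize_inf, realize_guard, realize_body]
  exact ⟨fun ⟨d, h⟩ => ⟨_, h⟩, fun ⟨d, h⟩ => ⟨fun r => d r.1 r.2, h⟩⟩

lemma realize_allFormula [Finite α] :
    (P.allFormula φ).Realize (Sum.elim y fun r => z r.1 r.2) ↔
      ∀ d : Fin P.m → α → M, P.Guards φ z d → ∀ t ∈ P.s, rel φ (d t) y := by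
  simp only [Pattern.allFormula, FirstOrder.Language.Formula.realize_iAlls,
    FirstOrder.Language.Formula.realize_imp]
  refine ⟨fun h d hd => ?_, fun h d hd => ?_⟩
  · exact (realize_body P φ y z _).1
      (h (fun r => d r.1 r.2) ((realize_guard P φ y z fun r => d r.1 r.2).2 hd))
  · exact (realize_body P φ y z d).2 (h _ ((realize_guard P φ y z d).1 hd))

instance : Finite (Pattern K) := by
  let f : Pattern K → Σ m : Fin (K + 1), Finset (Fin m) ×
      Σ sub : Fin m → Finset (Fin K), (t : Fin m) → {i // i ∈ sub t} → Fin 2 :=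
    fun P => ⟨⟨P.m, Nat.lt_succ_of_le P.m_le⟩, P.s, P.sub, P.sign⟩
  refine Finite.of_injective f ?_
  rintro ⟨m, hm, s, sub, sign⟩ ⟨m', hm', s', sub', sign'⟩ h
  simp only [f, Sigma.mk.injEq, Fin.mk.injEq] at h
  obtain ⟨rfl, h⟩ := h
  simp only [heq_eq_eq, Prod.mk.injEq, Sigma.mk.injEq] at h
  obtain ⟨rfl, rfl, h⟩ := h
  rw [eq_of_heq h]

end Semantics

/-! ### A uniform dimension bound by compactness -/

section Shattering

variable {L : FirstOrder.Language.{u, v}} {α : Type u'} {β : Type v'}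

/-- The sentence saying that some `n`-tuple is shattered by the instances of `φ`. -/
noncomputable def shatterSentence [Finite α] [Finite β] (φ : L.Formula (α ⊕ β)) (n : ℕ) :
    L.Sentence :=
  FirstOrder.Language.Formula.iExs (Fin n × α)
    (FirstOrder.Language.Formula.iInf fun S : Fin n → Fin 2 =>
      FirstOrder.Language.Formula.iExs β
        (FirstOrder.Language.Formula.iInf fun j : Fin n =>
          signed (φ.relabel (Sum.elim (fun i => Sum.inl (Sum.inr (j, i))) Sum.inr)) (S j)))

lemma realize_shatterSentence [Finite α] [Finite β] (φ : L.Formula (α ⊕ β)) (n : ℕ)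
    (M : Type w) [L.Structure M] : M ⊨ shatterSentence φ n ↔
      ∃ x : Fin n → α → M, ShattersTuple (flip (rel φ)) x := by
  have key : M ⊨ shatterSentence φ n ↔ ∃ x : Fin n × α → M, ∀ S : Fin n → Fin 2, ∃ a : β → M,
      ∀ j, rel φ (fun i => x (j, i)) a ↔ S j = 0 := by
    simp only [shatterSentence, FirstOrder.Language.Sentence.Realize,
      FirstOrder.Language.Formula.realize_iExs, FirstOrder.Language.Formula.realize_iInf,
      realize_signed, FirstOrder.Language.Formula.realize_relabel, rel]
    refine exists_congr fun x => forall_congr' fun S => exists_congr fun a => forall_congr' fun j => ?_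
    congr! 2
    funext a
    rcases a with a | a <;> rfl
  rw [key]
  constructor
  · rintro ⟨x, hx⟩
    classical
    refine ⟨fun j i => x (j, i), fun S => ?_⟩
    obtain ⟨a, ha⟩ := hx fun j => if j ∈ S then 0 else 1
    exact ⟨a, fun j => (ha j).trans (by split_ifs <;> simp_all)⟩
  · rintro ⟨x, hx⟩
    exact ⟨fun r => x r.1 r.2, fun S => hx {j | S j = 0}⟩

lemma ShattersTuple.shatters {M : Type w} [L.Structure M] {φ : L.Formula (α ⊕ β)} {n : ℕ}
    {x : Fin n → α → M} (hx : ShattersTuple (flip (rel φ)) x) :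
    ∃ A : Finset (α → M), A.card = n ∧
      Shatters {B : Set (α → M) | ∃ a : β → M, B = solutionSet φ a} (A : Set (α → M)) := by
  refine ⟨Finset.univ.map ⟨x, hx.injective⟩, by simp, fun S hS => ?_⟩
  obtain ⟨a, ha⟩ := hx {j | x j ∈ S}
  refine ⟨_, ⟨a, rfl⟩, Set.ext fun b => ⟨fun ⟨h1, h2⟩ => ?_, fun hb => ⟨?_, hS hb⟩⟩⟩
  · obtain ⟨j, -, rfl⟩ := Finset.mem_map.1 (Finset.mem_coe.1 h2)
    exact (ha j).1 h1
  · obtain ⟨j, -, rfl⟩ := Finset.mem_map.1 (Finset.mem_coe.1 (hS hb))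
    exact (ha j).2 hb

lemma Shatters.shattersTuple {M : Type w} [L.Structure M] {φ : L.Formula (α ⊕ β)}
    {A : Finset (α → M)}
    (h : Shatters {B : Set (α → M) | ∃ a : β → M, B = solutionSet φ a} (A : Set (α → M))) :
    ShattersTuple (flip (rel φ)) fun j : A => j.1 := by
  intro S
  obtain ⟨_, ⟨a, rfl⟩, ha⟩ := h (Subtype.val '' S) (by rintro _ ⟨j, -, rfl⟩; exact j.2)
  refine ⟨a, fun j => ?_⟩
  have := Set.ext_iff.1 ha j.1
  simp only [Set.mem_inter_iff, Finset.mem_coe, j.2, and_true, Set.mem_image,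
    Subtype.val_inj, exists_eq_right] at this
  exact this

/-- By compactness, the dimension of an NIP formula is bounded uniformly in the models of `T`. -/
theorem IsNIP.exists_uniform_bound [Finite α] [Finite β] {T : L.Theory} {φ : L.Formula (α ⊕ β)}
    (h : IsNIP.{u, v, max u v w} T φ) :
    ∃ n : ℕ, ∀ (M : FirstOrder.Language.Theory.ModelType.{u, v, max u v w} T) (x : Fin n → α → M),
      ¬ ShattersTuple (flip (rel φ)) x := by
  by_contra! hcon
  -- Taking all sentences up to n makes the chain increasing; a shattered n-tuple restricts to
  -- shattered shorter ones, so one model satisfies the whole stage.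
  let T' : ℕ → L.Theory := fun n => T ∪ shatterSentence φ '' Set.Iic n
  have hsat : FirstOrder.Language.Theory.IsSatisfiable (⋃ n, T' n) := by
    rw [FirstOrder.Language.Theory.isSatisfiable_directed_union_iff]
    · intro n
      obtain ⟨M, x, hx⟩ := hcon n
      have : M ⊨ T' n := by
        refine FirstOrder.Language.Theory.Model.union inferInstance ⟨?_⟩
        rintro _ ⟨k, hk, rfl⟩
        exact (realize_shatterSentence φ k M).2 ⟨_, hx.comp (Fin.castLE_injective hk)⟩
      exact FirstOrder.Language.Theory.Model.isSatisfiable M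
    · refine Monotone.directed_le fun k n hkn => ?_
      exact Set.union_subset_union_right _ (Set.image_mono (Set.Iic_subset_Iic.2 hkn))
  obtain ⟨N⟩ := hsat
  -- Compactness yields a model in universe max u v; it is lifted to the universe over which NIP is
  -- assumed.
  let N' : FirstOrder.Language.Theory.ModelType.{u, v, max u v w} (⋃ n, T' n) :=
    FirstOrder.Language.Theory.ModelType.ulift.{u, v, max u v, w} N
  have hT : T ⊆ ⋃ n, T' n := Set.subset_iUnion_of_subset 0 Set.subset_union_left
  obtain ⟨n, hn⟩ := h (N'.subtheoryModel hT)
  have hreal : N' ⊨ shatterSentence φ n :=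
    FirstOrder.Language.Theory.realize_sentence_of_mem (⋃ n, T' n)
      (Set.mem_iUnion.2 ⟨n, Or.inr ⟨n, Set.mem_Iic.2 le_rfl, rfl⟩⟩)
  obtain ⟨x, hx⟩ := (realize_shatterSentence φ n N').1 hreal
  obtain ⟨A, hA, hsh⟩ := hx.shatters
  exact hn A hA hsh

end Shattering

/-! ### From votes to formulas, coding patterns, and counting types -/

section Definability

variable {L : FirstOrder.Language.{u, v}} {α : Type u'} {β : Type v'}

lemma exists_subset_range {X : Type*} [Nonempty X] {K : ℕ} (D : Finset X) (hD : D.card ≤ K) :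
    ∃ g : Fin K → X, ∀ x ∈ D, ∃ i, g i = x := by
  obtain ⟨x₀⟩ := ‹Nonempty X›
  refine ⟨fun i => if h : i.1 < D.card then (D.equivFin.symm ⟨i, h⟩).1 else x₀, fun x hx => ?_⟩
  refine ⟨Fin.castLE hD (D.equivFin ⟨x, hx⟩), ?_⟩
  simp

lemma exists_patterns_iff [Finite α] (n : ℕ) (φ : L.Formula (α ⊕ β)) :
    ∃ K : ℕ, ∀ (M : Type w) [L.Structure M],
      (∀ x : Fin n → β → M, ¬ ShattersTuple (rel (M := M) φ) x) →
      ∀ A : Set (β → M), A.Finite → A.Nonempty → ∀ b : α → M,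
        ∃ (N : ℕ) (P : Fin N → Pattern K) (a : Fin K → β → M), (∀ i, a i ∈ A) ∧ ∀ y ∈ A,
          (rel φ b y ↔ ∃ r, ((P r).exFormula φ).Realize (Sum.elim y fun r => a r.1 r.2)) ∧
          (rel φ b y ↔ ∃ r, ((P r).allFormula φ).Realize (Sum.elim y fun r => a r.1 r.2)) := by
  classical
  obtain ⟨k, m, hkm⟩ := exists_majority_of_isolated.{max v' w} n
  -- K must bound both the m quantified tuples and the at most m * k isolating parameters.
  refine ⟨m + m * k, fun M _ hM A hA hAne b => ?_⟩
  have := hA.fintype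
  have := hAne.to_subtype
  let C : Finset (A → Bool) := Finset.univ.filter fun q => ∃ d : α → M, ∀ x : A, q x = true ↔ rel φ d x
  have hC : ∀ x : Fin n → A, ¬ ShattersTuple (evalRel C) x := by
    intro x hx
    refine hM (fun j => (x j).1) fun S => ?_
    obtain ⟨⟨q, hq⟩, hqS⟩ := hx S
    obtain ⟨d, hd⟩ := (Finset.mem_filter.1 hq).2
    exact ⟨d, fun j => (hd (x j)).symm.trans (hqS j)⟩
  have hmem : ∀ d : α → M, (fun x : A => decide (rel φ d x)) ∈ C := fun d =>
    Finset.mem_filter.2 ⟨Finset.mem_univ _, d, fun x => decide_eq_true_iff⟩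
  obtain ⟨q, D, hq, hmaj⟩ := hkm C hC _ (hmem b)
  choose d hd using fun t => (Finset.mem_filter.1 (hq t).1).2
  obtain ⟨g, hg⟩ := exists_subset_range (K := m + m * k) (Finset.univ.biUnion D) (by
    have := Finset.card_biUnion_le_card_mul Finset.univ D k fun t _ => (hq t).2.1
    rw [Finset.card_univ, Fintype.card_fin] at this
    omega)
  let I := {s : Finset (Fin m) // m < 2 * s.card}
  -- Each guard records the complete sign pattern of the voter d t on all parameters; only the
  -- majority s varies between disjuncts.
  let Q : I → Pattern (m + m * k) := fun s =>
    ⟨m, Nat.le_add_right _ _, s.1, fun _ => Finset.univ, fun t i => if rel φ (d t) (g i) then 0 else 1⟩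
  have hguard : ∀ (s : I) (e : Fin m → α → M), (Q s).Guards φ (fun i => (g i).1) e ↔
      ∀ t i, rel φ (e t) (g i) ↔ rel φ (d t) (g i) := by
    intro s e
    refine forall_congr' fun t => ⟨fun h i => (h ⟨i, Finset.mem_univ i⟩).trans ?_,
      fun h i => (h i).trans ?_⟩ <;>
    · simp only [Q]
      split_ifs <;> simp_all
  -- Isolation at work: agreement with the voters on the parameters forces agreement on all of A.
  -- This is why the existential and universal forms coincide there.
  have hiso : ∀ (s : I) (e : Fin m → α → M), (Q s).Guards φ (fun i => (g i).1) e →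
      ∀ t (x : A), rel φ (e t) x ↔ q t x = true := by
    intro s e he t x
    rw [hguard] at he
    have := (hq t).2.2 _ (hmem (e t)) fun x hx => by
      obtain ⟨i, rfl⟩ := hg x (Finset.mem_biUnion.2 ⟨t, Finset.mem_univ t, hx⟩)
      rw [Bool.eq_iff_iff, decide_eq_true_iff, hd, he]
    rw [← this, decide_eq_true_iff]
  have hself : ∀ s : I, (Q s).Guards φ (fun i => (g i).1) d := fun s =>
    (hguard s d).2 fun _ _ => Iff.rfl
  have hvote : ∀ y : A, rel φ b y ↔ ∃ s : I, ∀ t ∈ s.1, q t y = true := by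
    intro y
    rw [← decide_eq_true_iff (p := rel φ b y), hmaj y]
    constructor
    · exact fun h => ⟨⟨_, h⟩, fun t ht => (Finset.mem_filter.1 ht).2⟩
    · rintro ⟨⟨s, hs⟩, h⟩
      refine hs.trans_le (Nat.mul_le_mul_left 2 (Finset.card_le_card fun t ht => ?_))
      exact Finset.mem_filter.2 ⟨Finset.mem_univ t, h t ht⟩
  let f := Fintype.equivFin I
  refine ⟨_, fun r => Q (f.symm r), fun i => (g i).1, fun i => (g i).2, fun y hy => ?_⟩
  rw [hvote ⟨y, hy⟩]
  constructor
  · refine Iff.trans (exists_congr fun s => ?_)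
      (f.symm.surjective.exists (p := fun s => ((Q s).exFormula φ).Realize _))
    rw [realize_exFormula (Q s) φ y fun i => (g i).1]
    refine ⟨fun h => ⟨d, hself s, fun t ht => (hiso s d (hself s) t ⟨y, hy⟩).2 (h t ht)⟩, ?_⟩
    rintro ⟨e, he, h⟩ t ht
    exact (hiso s e he t ⟨y, hy⟩).1 (h t ht)
  · refine Iff.trans (exists_congr fun s => ?_)
      (f.symm.surjective.exists (p := fun s => ((Q s).allFormula φ).Realize _))
    rw [realize_allFormula (Q s) φ y fun i => (g i).1]
    exact ⟨fun h e he t ht => (hiso s e he t ⟨y, hy⟩).2 (h t ht),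
      fun h t ht => (hiso s d (hself s) t ⟨y, hy⟩).1 (h d (hself s) t ht)⟩

lemma defines_iff {φ : L.Formula (α ⊕ β)} {M : Type w} [L.Structure M] {A : Set (β → M)}
    {p : Set ((L[[M]]).Formula α)} {b : α → M} (hb : ∀ a ∈ A, withParams φ a ∈ p ↔ rel φ b a)
    {k : ℕ} (ψ : L.Formula (β ⊕ Fin k × β)) (c : Fin k → β → M) :
    Defines φ A p (withTuples ψ c) ↔
      ∀ y ∈ A, rel φ b y ↔ ψ.Realize (Sum.elim y fun r => c r.1 r.2) := by
  refine forall_congr' fun y => forall_congr' fun hy => ?_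
  rw [realize_withTuples, hb y hy]
  exact iff_comm

theorem IsNIP.hasDefinitions [Finite α] [Finite β] {T : L.Theory} {φ : L.Formula (α ⊕ β)}
    (h : IsNIP.{u, v, max u v w} T φ) :
    HasExDefinitions.{u, v, max u v w} T φ ∧ HasAllDefinitions.{u, v, max u v w} T φ := by
  obtain ⟨n, hn⟩ := h.exists_uniform_bound
  obtain ⟨K, hK⟩ := exists_patterns_iff (L := L) (2 ^ n) φ
  refine ⟨⟨K, fun M A hA hne p hp => ?_⟩, ⟨K, fun M A hA hne p hp => ?_⟩⟩ <;>
  · obtain ⟨b, hb⟩ := hp.exists_realization hA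
    obtain ⟨N, P, a, ha, hP⟩ := hK M (not_shattersTuple_flip (hn M)) A hA hne b
    refine ⟨N, P, a, ha, (defines_iff hb _ _).2 fun y hy => ?_⟩
    rw [FirstOrder.Language.Formula.realize_iSup]
    first
    | exact (hP y hy).1
    | exact (hP y hy).2

/-- Finitely many formulas can be coded into one by means of equalities between parameters. -/
theorem HasUniformShape.hasUDTFS [Finite β] {T : L.Theory} {φ : L.Formula (α ⊕ β)}
    {shape : (K : ℕ) → Pattern K → L.Formula (β ⊕ Fin K × β)}
    (h : HasUniformShape.{u, v, w} T φ shape) : HasUDTFS.{u, v, w} T φ := by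
  classical
  obtain ⟨K, hK⟩ := h
  -- Besides the K original parameters, each pattern gets a pair of tuples whose equality switches
  -- its disjunct on.
  let J := Fin K ⊕ Pattern K × Bool
  have : Fintype J := Fintype.ofFinite J
  let e : J ≃ Fin (Fintype.card J) := Fintype.equivFin J
  let eqv : Pattern K → L.Formula (β ⊕ Fin (Fintype.card J) × β) := fun P =>
    FirstOrder.Language.Formula.iInf fun j : β =>
      FirstOrder.Language.Term.equal
        (FirstOrder.Language.Term.var (Sum.inr (e (Sum.inr (P, false)), j)))
        (FirstOrder.Language.Term.var (Sum.inr (e (Sum.inr (P, true)), j)))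
  refine ⟨Fintype.card J, FirstOrder.Language.Formula.iSup fun P : Pattern K =>
    eqv P ⊓ (shape K P).relabel (Sum.map id (Prod.map (fun i => e (Sum.inl i)) id)),
    fun M A hA hcard p hp => ?_⟩
  obtain ⟨a₀, ha₀, a₁, ha₁, hne⟩ := (Set.one_lt_ncard hA).1 hcard
  obtain ⟨n, P, a, ha, hdef⟩ := hK M A hA ⟨a₀, ha₀⟩ p hp
  -- The two tuples of a pair differ, as a₀ and a₁, exactly for the patterns not in use; this is
  -- where two elements of A are needed.
  let c' : J → β → M := Sum.elim a fun r => if r.2 = true ∧ r.1 ∉ Set.range P then a₁ else a₀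
  refine ⟨fun i => c' (e.symm i), fun i => ?_, fun y hy => ?_⟩
  · change c' (e.symm i) ∈ A
    rcases e.symm i with i | r
    · exact ha i
    · simp only [c', Sum.elim_inr]
      split_ifs <;> assumption
  rw [← hdef y hy, realize_withTuples, realize_withTuples]
  simp only [FirstOrder.Language.Formula.realize_iSup, FirstOrder.Language.Formula.realize_inf,
    FirstOrder.Language.Formula.realize_relabel]
  have heqv : ∀ Q, (eqv Q).Realize (Sum.elim y fun r => c' (e.symm r.1) r.2) ↔ Q ∈ Set.range P := by
    intro Q
    simp only [eqv, FirstOrder.Language.Formula.realize_iInf,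
      FirstOrder.Language.Formula.realize_equal, FirstOrder.Language.Term.realize_var,
      Sum.elim_inr, Equiv.symm_apply_apply, c', ← funext_iff]
    by_cases hQ : Q ∈ Set.range P <;> simp [hQ, hne]
  have hshape : ∀ Q, (shape K Q).Realize ((Sum.elim y fun r => c' (e.symm r.1) r.2) ∘
      Sum.map id (Prod.map (fun i => e (Sum.inl i)) id)) ↔
        (shape K Q).Realize (Sum.elim y fun r => a r.1 r.2) := by
    intro Q
    congr! 1
    funext x
    rcases x with x | x <;> simp [c']
  simp only [heqv, hshape, Set.mem_range]
  constructor
  · rintro ⟨_, ⟨r, rfl⟩, h⟩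
    exact ⟨r, h⟩
  · rintro ⟨r, h⟩
    exact ⟨_, ⟨r, rfl⟩, h⟩

lemma exists_pow_lt_two_pow (k : ℕ) : ∃ n : ℕ, 2 ≤ n ∧ n ^ k < 2 ^ n := by
  have h := isLittleO_pow_const_const_pow_of_one_lt (R := ℝ) k (r := 2) (by norm_num)
  obtain ⟨n, hn, hn2⟩ := ((h.def (c := 1 / 2) (by norm_num)).and
    (Filter.eventually_ge_atTop 2)).exists
  refine ⟨n, hn2, ?_⟩
  simp only [norm_pow, Real.norm_natCast, Real.norm_ofNat] at hn
  have h2 : (0 : ℝ) < 2 ^ n := by positivity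
  have : (n : ℝ) ^ k < 2 ^ n := by linarith
  exact_mod_cast this

/-- Counting types: uniform definability gives polynomially many types over finite sets. -/
theorem HasUDTFS.isNIP {T : L.Theory} {φ : L.Formula (α ⊕ β)} (h : HasUDTFS.{u, v, w} T φ) :
    IsNIP.{u, v, w} T φ := by
  obtain ⟨k, ψ, hψ⟩ := h
  obtain ⟨n, hn2, hn⟩ := exists_pow_lt_two_pow k
  intro M
  have hdual : ∀ y : Fin n → β → M, ¬ ShattersTuple (rel φ) y := by
    intro y hy
    choose b hb using hy
    -- The parameters come from the range of y, so a definition is recorded by k indices below n.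
    -- There are only n ^ k such codes for the 2 ^ n subsets.
    have hdef : ∀ S : Set (Fin n), ∃ c : Fin k → Fin n, ∀ j,
        j ∈ S ↔ ψ.Realize (Sum.elim (y j) fun r => y (c r.1) r.2) := by
      intro S
      obtain ⟨p, hp, hpb⟩ := exists_isPhiType φ (Set.range y) (b S)
      obtain ⟨c, hc, hdef⟩ := hψ M (Set.range y) (Set.finite_range y) (by
        rw [← Set.image_univ, Set.ncard_image_of_injective _
          (ShattersTuple.injective fun S => ⟨b S, hb S⟩), Set.ncard_univ, Nat.card_fin]
        exact hn2) p hp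
      choose c' hc' using hc
      refine ⟨c', fun j => ?_⟩
      rw [← hb S j, (defines_iff hpb ψ c).1 hdef (y j) ⟨j, rfl⟩]
      simp only [hc']
    choose c hc using hdef
    have hinj : Function.Injective c := by
      intro S S' hS
      ext j
      rw [hc S j, hc S' j, hS]
    have := Fintype.card_le_of_injective c hinj
    simp only [Fintype.card_set, Fintype.card_fin, Fintype.card_fun] at this
    omega
  -- The counting bounds the dimension on the parameter side by n; dualizing back costs the
  -- exponential.
  refine ⟨2 ^ n, fun A hA hsh => ?_⟩
  exact not_shattersTuple_flip hdual _
    (hsh.shattersTuple.comp (A.equivFinOfCardEq hA).symm.injective)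

end Definability

end UDTFS

theorem mainTheorem1 {L : FirstOrder.Language.{u, v}} {α : Type u'} {β : Type v'}
    [Finite α] [Finite β] (T : L.Theory) (φ : L.Formula (α ⊕ β)) :
    List.TFAE
      [UDTFS.IsNIP.{u, v, max u v w} T φ,
       UDTFS.HasExDefinitions.{u, v, max u v w} T φ,
       UDTFS.HasAllDefinitions.{u, v, max u v w} T φ,
       UDTFS.HasUDTFS.{u, v, max u v w} T φ] := by
  tfae_have 1 → 2 := fun h => (UDTFS.IsNIP.hasDefinitions.{u, v, w} h).1
  tfae_have 1 → 3 := fun h => (UDTFS.IsNIP.hasDefinitions.{u, v, w} h).2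
  tfae_have 2 → 4 := UDTFS.HasUniformShape.hasUDTFS
  tfae_have 3 → 4 := UDTFS.HasUniformShape.hasUDTFS
  tfae_have 4 → 1 := UDTFS.HasUDTFS.isNIP
  tfae_finish
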